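/- For $n \geq 2$ let $\mathcal{U}_{nc}(n)$ be the universal unital $C^*$-algebra with generators $u_{ij}$, $1 \leq i,j \leq n$, subject to the relation that the matrix $(u_{ij})$ is unitary in $M_n(\mathcal{U}_{nc}(n))$, and let $\mathcal{V}_n=\mathrm{span}\{1,u_{ij},u_{ij}^*: 1 \leq i,j \leq n\} \subseteq \mathcal{U}_{nc}(n)$, an operator system whose cones $M_p(\mathcal{V}_n)_+$ consist of the matrices over $\mathcal{V}_n$ that are positive in $M_p(\mathcal{U}_{nc}(n))$. Write $v_{k\ell}$ for the generators of $\mathcal{U}_{nc}(m)$. For operator systems $\mathcal{S},\mathcal{T}$, the maximal tensor product $\mathcal{S} \otimes_{\max} \mathcal{T}$ is the vector space $\mathcal{S} \otimes \mathcal{T}$ in which a self-adjoint $X \in M_k(\mathcal{S} \otimes \mathcal{T})$ is positive if and only if for every $\varepsilon>0$ there are $p,q$, $P \in M_p(\mathcal{S})_+$, $Q \in M_q(\mathcal{T})_+$ and a linear map $A:\mathbb{C}^k \to \mathbb{C}^p \otimes \mathbb{C}^q$ with $X+\varepsilon I_k=A^*(P \otimes Q)A$, where $I_k$ is the $k \times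 k$ diagonal matrix with diagonal entries $1 \otimes 1$. A state on $\mathcal{S} \otimes_{\max} \mathcal{T}$ is a linear functional $s$ on $\mathcal{S} \otimes \mathcal{T}$ with $s(1 \otimes 1)=1$ and $s(x) \geq 0$ for every positive $x \in \mathcal{S} \otimes_{\max} \mathcal{T}$. For $n,m \geq 2$ let $$B_{qmax}(n,m)=\Big\{ \sum_{i,j,k,\ell} s(u_{ij} \otimes v_{k\ell})\, E_{ij} \otimes E_{k\ell} \;:\; s \text{ a state on } \mathcal{V}_n \otimes_{\max} \mathcal{V}_m \Big\} \subseteq M_n \otimes M_m=M_{nm},$$ where $E_{ij}$ are the matrix units, and let $\|X\|_{qmax}=\inf\{r>0: X \in r B_{qmax}(n,m)\}$ for $X \in M_{nm}$. **Theorem.** For all $n,m \geq 2$, $$B_{qmax}(n,m)=\{X \in M_{nm}: \|X\| \leq 1\},$$ where $\|\cdot\|$ is the operator norm on $M_{nm}$ (acting on the Hilbert space $\mathbb{C}^n \otimes \mathbb{C}^m$). Consequently $\|X\|_{qmax}=\|X\|$ for every $X \in M_{nm}$; that is, the norm with closed unit ball $B_{qmax}(n,m)$ is the operator norm. -/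

import Mathlib

open scoped TensorProduct ENNReal ComplexOrder Matrix.Norms.L2Operator

noncomputable section

namespace QMax

/-! ### The universal C⋆-algebra `U_nc(n)` -/

/-- An `n × n` matrix `W` with entries in a nonzero unital C⋆-algebra `A` which is unitary in
`M_n(A)`. A unital C⋆-algebra generated by `n²` elements is separable, hence has at most the
cardinality of the continuum and is isomorphic to one whose carrier lies in `Type`; so letting `A`
range over `Type` captures all unitary matrices over unital C⋆-algebras. -/
structure UnitaryMatrix (n : ℕ) : Type 1 where
  A : Type
  [cstar : CStarAlgebra A]
  [nontriv : Nontrivial A]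
  W : Matrix (Fin n) (Fin n) A
  isUnitary : W ∈ unitary (Matrix (Fin n) (Fin n) A)

attribute [instance] UnitaryMatrix.cstar UnitaryMatrix.nontriv

/-- The entries of a unitary matrix over a C⋆-algebra are contractions. -/
theorem UnitaryMatrix.norm_entry_le {n : ℕ} (ω : UnitaryMatrix n) (i j : Fin n) :
    ‖ω.W i j‖ ≤ 1 := by
  let _ : PartialOrder ω.A := CStarAlgebra.spectralOrder ω.A
  let _ : StarOrderedRing ω.A := CStarAlgebra.spectralOrderedRing ω.A
  have h : (star ω.W * ω.W) j j = 1 := by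
    rw [(Unitary.mem_iff.mp ω.isUnitary).1, Matrix.one_apply_eq]
  rw [Matrix.mul_apply] at h
  have h1 : star (ω.W i j) * ω.W i j ≤ 1 := by
    rw [← h]
    exact Finset.single_le_sum (f := fun k => star ω.W j k * ω.W k j)
      (fun k _ => star_mul_self_nonneg (ω.W k j)) (Finset.mem_univ i)
  have h2 := CStarAlgebra.norm_le_norm_of_nonneg_of_le (star_mul_self_nonneg _) h1
  rw [CStarRing.norm_star_mul_self, CStarRing.norm_one] at h2
  nlinarith [norm_nonneg (ω.W i j)]

/-- The C⋆-algebra of all bounded families `(a_ω)`, where `ω` runs through all unitary `n × n`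
matrices over C⋆-algebras and `a_ω` lies in the algebra of the entries of `ω`. -/
abbrev UnitaryProd (n : ℕ) : Type 1 := lp (fun ω : UnitaryMatrix n => ω.A) ∞

instance instCStarAlgebraUnitaryProd (n : ℕ) : CStarAlgebra (UnitaryProd n) where

/-- The family of the `(i, j)` entries of all unitary `n × n` matrices. -/
def entryFamily (n : ℕ) (i j : Fin n) : UnitaryProd n :=
  ⟨fun ω => ω.W i j, memℓp_infty ⟨1, by rintro _ ⟨ω, rfl⟩; exact ω.norm_entry_le i j⟩⟩

/-- The C⋆-subalgebra generated by the entries of the universal unitary matrix. -/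
def uncSubalgebra (n : ℕ) : StarSubalgebra ℂ (UnitaryProd n) :=
  (StarAlgebra.adjoin ℂ {a | ∃ i j, a = entryFamily n i j}).topologicalClosure

instance instIsClosedUncSubalgebra (n : ℕ) :
    IsClosed (uncSubalgebra n : Set (UnitaryProd n)) :=
  StarSubalgebra.isClosed_topologicalClosure _

/-- `U_nc(n)`: the universal unital C⋆-algebra with generators `u_ij` subject to the relation that
the matrix `(u_ij)` is unitary. Its universal property is `Unc.existsUnique_starAlgHom`. -/
abbrev Unc (n : ℕ) : Type 1 := uncSubalgebra n

/-- The generators `u_ij` of `U_nc(n)`. -/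
def Unc.u {n : ℕ} (i j : Fin n) : Unc n :=
  ⟨entryFamily n i j, StarSubalgebra.le_topologicalClosure _
    (StarAlgebra.subset_adjoin ℂ _ ⟨i, j, rfl⟩)⟩

/-- Evaluation of an element of `U_nc(n)` at a unitary matrix. -/
def Unc.eval {n : ℕ} (ω : UnitaryMatrix n) : Unc n →⋆ₐ[ℂ] ω.A where
  toFun x := (x : UnitaryProd n) ω
  map_one' := rfl
  map_mul' _ _ := rfl
  map_zero' := rfl
  map_add' _ _ := rfl
  commutes' _ := rfl
  map_star' _ := rfl

theorem Unc.eval_apply {n : ℕ} (ω : UnitaryMatrix n) (x : Unc n) :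
    Unc.eval ω x = (x : UnitaryProd n) ω := rfl

/-- The matrix of generators is unitary. -/
theorem Unc.u_mem_unitary (n : ℕ) :
    (Matrix.of fun i j => (Unc.u i j : Unc n)) ∈ unitary (Matrix (Fin n) (Fin n) (Unc n)) := by
  have key (ω : UnitaryMatrix n) := Unitary.mem_iff.mp ω.isUnitary
  refine Unitary.mem_iff.mpr ⟨?_, ?_⟩
  · ext i j ω
    have h := congrFun (congrFun (key ω).1 i) j
    rw [Matrix.mul_apply] at h ⊢
    rw [Matrix.one_apply] at h ⊢
    have e : (((∑ k, star (Matrix.of fun i j => (Unc.u i j : Unc n)) i k *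
        (Matrix.of fun i j => (Unc.u i j : Unc n)) k j : Unc n) : UnitaryProd n) : ∀ ω, ω.A) ω =
        ∑ k, star ω.W i k * ω.W k j := by
      rw [← Unc.eval_apply, map_sum]
      rfl
    rw [e, h]
    split_ifs <;> rfl
  · ext i j ω
    have h := congrFun (congrFun (key ω).2 i) j
    rw [Matrix.mul_apply] at h ⊢
    rw [Matrix.one_apply] at h ⊢
    have e : (((∑ k, (Matrix.of fun i j => (Unc.u i j : Unc n)) i k *
        star (Matrix.of fun i j => (Unc.u i j : Unc n)) k j : Unc n) : UnitaryProd n) : ∀ ω, ω.A) ω =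
        ∑ k, ω.W i k * star ω.W k j := by
      rw [← Unc.eval_apply, map_sum]
      rfl
    rw [e, h]
    split_ifs <;> rfl

/-- The universal property: a unitary matrix over a unital C⋆-algebra is the image of `(u_ij)`
under a unique unital ⋆-homomorphism. -/
theorem Unc.existsUnique_starAlgHom {n : ℕ} {A : Type} [CStarAlgebra A]
    (a : Matrix (Fin n) (Fin n) A) (ha : a ∈ unitary (Matrix (Fin n) (Fin n) A)) :
    ∃! π : Unc n →⋆ₐ[ℂ] A, ∀ i j, π (Unc.u i j) = a i j := by
  have hex : ∃ π : Unc n →⋆ₐ[ℂ] A, ∀ i j, π (Unc.u i j) = a i j := by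
    rcases subsingleton_or_nontrivial A with hA | hA
    · exact ⟨{ toFun := fun _ => 0
               map_one' := Subsingleton.elim _ _
               map_mul' := fun _ _ => Subsingleton.elim _ _
               map_zero' := rfl
               map_add' := fun _ _ => Subsingleton.elim _ _
               commutes' := fun _ => Subsingleton.elim _ _
               map_star' := fun _ => Subsingleton.elim _ _ }, fun _ _ => Subsingleton.elim _ _⟩
    · exact ⟨Unc.eval ⟨A, a, ha⟩, fun _ _ => rfl⟩
  obtain ⟨π, hπ⟩ := hex
  refine ⟨π, hπ, fun ρ hρ => ?_⟩
  have hcρ : Continuous ρ :=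
    AddMonoidHomClass.continuous_of_bound ρ 1 fun x => by
      rw [one_mul]; exact NonUnitalStarAlgHom.norm_apply_le ρ x
  have hcπ : Continuous π :=
    AddMonoidHomClass.continuous_of_bound π 1 fun x => by
      rw [one_mul]; exact NonUnitalStarAlgHom.norm_apply_le π x
  refine StarAlgHom.ext fun z => ?_
  have hz : (z : UnitaryProd n) ∈
      closure (StarAlgebra.adjoin ℂ {a | ∃ i j, a = entryFamily n i j} : Set (UnitaryProd n)) := z.2
  have hin : ∀ y (hy : y ∈ StarAlgebra.adjoin ℂ {a | ∃ i j, a = entryFamily n i j}),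
      ρ ⟨y, StarSubalgebra.le_topologicalClosure _ hy⟩ =
        π ⟨y, StarSubalgebra.le_topologicalClosure _ hy⟩ := by
    intro y hy
    induction hy using StarAlgebra.adjoin_induction with
    | mem x hx =>
      obtain ⟨i, j, rfl⟩ := hx
      exact (hρ i j).trans (hπ i j).symm
    | algebraMap r => exact (AlgHomClass.commutes ρ r).trans (AlgHomClass.commutes π r).symm
    | add x y hx hy h1 h2 =>
      exact (map_add ρ ⟨x, _⟩ ⟨y, _⟩).trans
        ((congrArg₂ (· + ·) h1 h2).trans (map_add π ⟨x, _⟩ ⟨y, _⟩).symm)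
    | mul x y hx hy h1 h2 =>
      exact (map_mul ρ ⟨x, _⟩ ⟨y, _⟩).trans
        ((congrArg₂ (· * ·) h1 h2).trans (map_mul π ⟨x, _⟩ ⟨y, _⟩).symm)
    | star x hx h1 =>
      exact (map_star ρ ⟨x, _⟩).trans ((congrArg star h1).trans (map_star π ⟨x, _⟩).symm)
  have hcl : IsClosed {w : Unc n | ρ w = π w} := isClosed_eq hcρ hcπ
  have hzc : z ∈ closure {w : Unc n | ρ w = π w} := by
    rw [closure_subtype]
    refine closure_mono (fun y hy => ?_) hz
    exact ⟨⟨y, StarSubalgebra.le_topologicalClosure _ hy⟩, hin y hy, rfl⟩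
  rw [hcl.closure_eq] at hzc
  exact hzc

/-! ### Operator systems and their maximal tensor product -/

/-- A (concrete) operator system in a unital C⋆-algebra `A`: a subspace which contains the unit and
is closed under the involution. -/
structure OperatorSystem (A : Type*) [CStarAlgebra A] extends Submodule ℂ A where
  one_mem' : (1 : A) ∈ carrier
  star_mem' : ∀ {a : A}, a ∈ carrier → star a ∈ carrier

namespace OperatorSystem

variable {A B : Type*} [CStarAlgebra A] [CStarAlgebra B]

/-- The unit of an operator system. -/
def unit (S : OperatorSystem A) : S.toSubmodule := ⟨1, S.one_mem'⟩

/-- The cone `M_p(S)₊`: those matrices over `S` which are positive in the C⋆-algebra `M_p(A)`,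
that is, of the form `Y⋆ Y` with `Y ∈ M_p(A)`. -/
def MatrixPos (S : OperatorSystem A) {p : ℕ} (X : Matrix (Fin p) (Fin p) S.toSubmodule) : Prop :=
  ∃ Y : Matrix (Fin p) (Fin p) A, X.map (fun x => (x : A)) = Y.conjTranspose * Y

/-- `P ⊗ Q ∈ M_{pq}(S ⊗ T)`, the matrix with entries `P_ij ⊗ Q_kl`. -/
def tensorMatrix (S : OperatorSystem A) (T : OperatorSystem B) {p q : ℕ}
    (P : Matrix (Fin p) (Fin p) S.toSubmodule) (Q : Matrix (Fin q) (Fin q) T.toSubmodule) :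
    Matrix (Fin p × Fin q) (Fin p × Fin q) (S.toSubmodule ⊗[ℂ] T.toSubmodule) :=
  Matrix.of fun i j => P i.1 j.1 ⊗ₜ[ℂ] Q i.2 j.2

/-- The compression `α⋆ Z α` of a matrix `Z` over a complex vector space `V` by a scalar
matrix `α`. -/
def compress {V ι κ : Type*} [AddCommGroup V] [Module ℂ V] [Fintype ι]
    (α : Matrix ι κ ℂ) (Z : Matrix ι ι V) : Matrix κ κ V :=
  Matrix.of fun a b => ∑ i, ∑ j, (star (α i a) * α j b) • Z i j

/-- The cone `M_k(S ⊗_max T)₊`: `X` belongs to it if for every `ε > 0` there are `P ∈ M_p(S)₊`,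
`Q ∈ M_q(T)₊` and a linear map `α : ℂᵏ → ℂᵖ ⊗ ℂ^q` with `X + ε I = α⋆ (P ⊗ Q) α`.
(Such an `X` is automatically self-adjoint.) -/
def MaxTensorPos (S : OperatorSystem A) (T : OperatorSystem B) {k : ℕ}
    (X : Matrix (Fin k) (Fin k) (S.toSubmodule ⊗[ℂ] T.toSubmodule)) : Prop :=
  ∀ ε : ℝ, 0 < ε → ∃ (p q : ℕ) (P : Matrix (Fin p) (Fin p) S.toSubmodule)
    (Q : Matrix (Fin q) (Fin q) T.toSubmodule) (α : Matrix (Fin p × Fin q) (Fin k) ℂ),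
    S.MatrixPos P ∧ T.MatrixPos Q ∧
      X + Matrix.diagonal (fun _ => (ε : ℂ) • (S.unit ⊗ₜ[ℂ] T.unit)) =
        compress α (tensorMatrix S T P Q)

/-- A state on `S ⊗_max T`: a linear functional which maps the unit to `1` and is nonnegative on
the positive elements of `S ⊗_max T` (the cone of `1 × 1` matrices). -/
structure IsMaxState (S : OperatorSystem A) (T : OperatorSystem B)
    (s : S.toSubmodule ⊗[ℂ] T.toSubmodule →ₗ[ℂ] ℂ) : Prop where
  map_unit : s (S.unit ⊗ₜ[ℂ] T.unit) = 1
  map_nonneg : ∀ x : S.toSubmodule ⊗[ℂ] T.toSubmodule,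
    S.MaxTensorPos T (Matrix.of fun _ _ : Fin 1 => x) → 0 ≤ s x

end OperatorSystem

/-! ### The operator systems `V_n` and the set `B_qmax(n, m)` -/

/-- `V_n = span {1, u_ij, u_ij⋆} ⊆ U_nc(n)`. -/
def V (n : ℕ) : OperatorSystem (Unc n) where
  toSubmodule := Submodule.span ℂ
    ({1} ∪ {a | ∃ i j, a = Unc.u i j} ∪ {a | ∃ i j, a = star (Unc.u i j)})
  one_mem' := Submodule.subset_span (Or.inl (Or.inl rfl))
  star_mem' := by
    intro a ha
    induction ha using Submodule.span_induction with
    | mem x hx =>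
      refine Submodule.subset_span ?_
      rcases hx with (hx | ⟨i, j, rfl⟩) | ⟨i, j, rfl⟩
      · left; left; rw [Set.mem_singleton_iff] at hx ⊢; rw [hx, star_one]
      · right; exact ⟨i, j, rfl⟩
      · left; right; exact ⟨i, j, star_star _⟩
    | zero => rw [star_zero]; exact Submodule.zero_mem _
    | add x y _ _ hx hy => rw [star_add]; exact Submodule.add_mem _ hx hy
    | smul c x _ hx => rw [star_smul]; exact Submodule.smul_mem _ _ hx

/-- The generators `u_ij` as elements of `V_n`. -/
def V.u {n : ℕ} (i j : Fin n) : (V n).toSubmodule :=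
  ⟨Unc.u i j, Submodule.subset_span (Or.inl (Or.inr ⟨i, j, rfl⟩))⟩

/-- The matrix `∑ s(u_ij ⊗ v_kl) E_ij ⊗ E_kl ∈ M_n ⊗ M_m = M_{nm}`, where `v_kl` are the generators
of `V_m`. Its entry in row `(i, k)` and column `(j, l)` is `s(u_ij ⊗ v_kl)`. -/
def correlationMatrix {n m : ℕ} (s : (V n).toSubmodule ⊗[ℂ] (V m).toSubmodule →ₗ[ℂ] ℂ) :
    Matrix (Fin n × Fin m) (Fin n × Fin m) ℂ :=
  Matrix.of fun r c => s (V.u r.1 c.1 ⊗ₜ[ℂ] V.u r.2 c.2)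

/-- `B_qmax(n, m)`. -/
def Bqmax (n m : ℕ) : Set (Matrix (Fin n × Fin m) (Fin n × Fin m) ℂ) :=
  {X | ∃ s, (V n).IsMaxState (V m) s ∧ X = correlationMatrix s}

/-- `‖X‖_qmax = inf {r > 0 : X ∈ r B_qmax(n, m)}`, the norm whose closed unit ball is
`B_qmax(n, m)`. -/
def qmaxNorm {n m : ℕ} (X : Matrix (Fin n × Fin m) (Fin n × Fin m) ℂ) : ℝ :=
  gauge (Bqmax n m) X

end QMax

end

noncomputable section

namespace QMax

open Matrix
open scoped MatrixOrder Kronecker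

/-! ### Positivity and contractions for complex matrices. -/

section MatrixLemmas

variable {ι : Type*} [Fintype ι]

/-! The positive matrix (1, u; u⋆, 1) controls all positivity in `V n`: a matrix of functionals is
positive on the matrix cones as soon as its values on this block matrix are positive semidefinite
(`sum_apply_nonneg`). After normalising the value at the unit, these values are 1 + H with H an
off-diagonal Hermitian contraction. H is the average of the unitaries H ± i√(1 - H²), and the blocks
of a unitary define a representation of `Unc n`. Using this in one tensor factor at a time, a unital
functional s is a state on the maximal tensor product iff its values N on (1, u; u⋆, 1) ⊗ (1, v; v⋆,
1) are positive semidefinite. A principal corner of N is (1, X; X⋆, 1) with X the correlation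
matrix, so ‖X‖ ≤ 1. Conversely, for a contraction X, choose s with values X on u ⊗ v, X⋆ on u⋆ ⊗ v⋆,
and 0 on the other nontrivial products; then N is the direct sum of (1, X; X⋆, 1) and an identity.
-/

theorem posSemidef_iff_dotProduct_complex (M : Matrix ι ι ℂ) :
    M.PosSemidef ↔ ∀ x : ι → ℂ, 0 ≤ star x ⬝ᵥ (M *ᵥ x) := by
  classical
  refine ⟨fun h => h.dotProduct_mulVec_nonneg, fun h => ?_⟩
  refine .of_dotProduct_mulVec_nonneg ?_ h
  -- Over ℂ a real-valued quadratic form already forces the matrix to be Hermitian.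
  rw [← isSymmetric_toEuclideanLin_iff, LinearMap.isSymmetric_iff_inner_map_self_real]
  intro v
  have h1 := (h v.ofLp)
  have h2 : inner ℂ (toEuclideanLin M v) v = star (star v.ofLp ⬝ᵥ (M *ᵥ v.ofLp)) := by
    rw [← inner_conj_symm, EuclideanSpace.inner_eq_star_dotProduct, dotProduct_comm]
    rfl
  rw [h2]
  have h3 : star (star v.ofLp ⬝ᵥ (M *ᵥ v.ofLp)) = star v.ofLp ⬝ᵥ (M *ᵥ v.ofLp) :=
    (IsSelfAdjoint.of_nonneg h1).star_eq
  rw [h3]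
  exact h3

theorem dotProduct_mulVec_eq_sum (M : Matrix ι ι ℂ) (x : ι → ℂ) :
    star x ⬝ᵥ (M *ᵥ x) = ∑ i, ∑ j, star (x i) * x j * M i j := by
  simp only [dotProduct, mulVec, Finset.mul_sum, Pi.star_apply]
  exact Finset.sum_congr rfl fun i _ => Finset.sum_congr rfl fun j _ => by ring

/-- A complex matrix is positive semidefinite if its quadratic form is nonnegative. -/
theorem posSemidef_iff_sum (M : Matrix ι ι ℂ) :
    M.PosSemidef ↔ ∀ x : ι → ℂ, 0 ≤ ∑ i, ∑ j, star (x i) * x j * M i j := by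
  rw [posSemidef_iff_dotProduct_complex]
  exact forall_congr' fun x => by rw [dotProduct_mulVec_eq_sum]

variable [DecidableEq ι]

theorem norm_le_one_of_sq {a : Matrix ι ι ℂ} (ha : aᴴ * a ≤ 1) : ‖a‖ ≤ 1 := by
  have h := (CStarAlgebra.norm_le_one_iff_of_nonneg (aᴴ * a)
    (posSemidef_conjTranspose_mul_self a).nonneg).2 ha
  rw [l2_opNorm_conjTranspose_mul_self] at h
  nlinarith [norm_nonneg a]

/-- The block matrix with off-diagonal block `X` and identity diagonal blocks is positive
semidefinite if and only if `X` is a contraction. -/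
theorem posSemidef_fromBlocks_one_iff (X : Matrix ι ι ℂ) :
    (fromBlocks 1 X Xᴴ 1).PosSemidef ↔ ‖X‖ ≤ 1 := by
  let _ : Invertible (1 : Matrix ι ι ℂ) := invertibleOne
  -- The Schur complement of the upper left block is 1 - X⋆X.
  rw [PosDef.fromBlocks₁₁ X 1 PosDef.one, inv_one, Matrix.mul_one, ← Matrix.le_iff]
  refine ⟨norm_le_one_of_sq, fun h => ?_⟩
  rw [← CStarAlgebra.norm_le_one_iff_of_nonneg (Xᴴ * X)
    (posSemidef_conjTranspose_mul_self X).nonneg, l2_opNorm_conjTranspose_mul_self]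
  nlinarith [norm_nonneg X]

/-- A Hermitian matrix between `-1` and `1` is a contraction. -/
theorem norm_sub_one_le_one {E : Matrix ι ι ℂ} (h0 : 0 ≤ E) (h2 : E ≤ 2) : ‖E - 1‖ ≤ 1 := by
  have hE : Eᴴ = E := (nonneg_iff_posSemidef.1 h0).1
  have hs : (E - 1)ᴴ = E - 1 := by rw [conjTranspose_sub, hE, conjTranspose_one]
  apply norm_le_one_of_sq
  rw [hs, ← sub_nonneg]
  have e1 : 0 ≤ E * (2 - E) * E := by
    have := star_left_conjugate_nonneg (sub_nonneg.2 h2) E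
    rwa [star_eq_conjTranspose, hE] at this
  have e2 : 0 ≤ (2 - E) * E * (2 - E) := by
    have := star_left_conjugate_nonneg h0 (2 - E)
    rwa [star_eq_conjTranspose, (nonneg_iff_posSemidef.1 (sub_nonneg.2 h2)).1] at this
  -- Since E and 2 - E commute and add up to 2, E(2 - E) is half a sum of two conjugations of
  -- positive matrices.
  have e3 : (1 : Matrix ι ι ℂ) - (E - 1) * (E - 1) =
      (2⁻¹ : ℝ) • (E * (2 - E) * E + (2 - E) * E * (2 - E)) := by
    have : E * (2 - E) * E + (2 - E) * E * (2 - E) = (2 : ℝ) • (1 - (E - 1) * (E - 1)) := by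
      rw [two_smul]
      noncomm_ring
    rw [this, smul_smul]
    norm_num
  rw [e3]
  exact smul_nonneg (by norm_num) (add_nonneg e1 e2)

end MatrixLemmas

/-! ### Representations from unitaries and Hermitian contractions. -/

/-- A unitary matrix with a fourfold block structure gives a representation of `U_nc(n)`. -/
theorem exists_rep_of_unitary {n : ℕ} {ι : Type} [Fintype ι] [DecidableEq ι]
    (w : Matrix ((Bool × Fin n) × ι) ((Bool × Fin n) × ι) ℂ) (hw : w ∈ unitary (Matrix _ _ ℂ)) :
    ∃ π : Unc n →⋆ₐ[ℂ] Matrix (Bool × ι) (Bool × ι) ℂ, ∀ i j a b,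
      π (Unc.u i j) (false, a) (false, b) = w ((false, i), a) ((true, j), b) := by
  have hw1 := (Unitary.mem_iff.1 hw).1
  have hw2 := (Unitary.mem_iff.1 hw).2
  obtain ⟨π, hπ, -⟩ := Unc.existsUnique_starAlgHom (n := n) (A := Matrix (Bool × ι) (Bool × ι) ℂ)
    -- Flipping the Boolean of the columns is a permutation, so unitarity survives, and it moves the
    -- off-diagonal block of `w` into the (false, false) corner.
    (Matrix.of fun i j => Matrix.of fun s t => w ((s.1, i), s.2) ((!t.1, j), t.2)) (by
      refine Unitary.mem_iff.2 ⟨?_, ?_⟩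
      · ext i j s t
        have h := congrFun (congrFun hw1 ((!s.1, i), s.2)) ((!t.1, j), t.2)
        rw [Matrix.mul_apply, Matrix.sum_apply]
        simp only [Matrix.mul_apply, star_apply, of_apply, Fintype.sum_prod_type] at h ⊢
        rw [Finset.sum_comm, h]
        simp only [one_apply, Prod.mk.injEq, Bool.not_inj_iff]
        split_ifs with h1 h2 h3 <;> simp_all [one_apply, Prod.ext_iff]
      · ext i j s t
        have h := congrFun (congrFun hw2 ((s.1, i), s.2)) ((t.1, j), t.2)
        rw [Matrix.mul_apply, Matrix.sum_apply]
        simp only [Matrix.mul_apply, star_apply, of_apply, Fintype.sum_prod_type] at h ⊢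
        rw [Finset.sum_comm, ← Equiv.sum_comp Equiv.boolNot]
        simp only [Equiv.boolNot_apply, Bool.not_not]
        rw [h]
        simp only [one_apply, Prod.mk.injEq]
        split_ifs with h1 h2 h3 <;> simp_all [one_apply, Prod.ext_iff])
  exact ⟨π, fun i j a b => by rw [hπ]; rfl⟩

/-- A block of a Hermitian contraction is an average of compressions of two representations, since
the contraction is the average of two unitaries. -/
theorem exists_rep_of_contraction {n : ℕ} {ι : Type} [Fintype ι] [DecidableEq ι]
    (H : Matrix ((Bool × Fin n) × ι) ((Bool × Fin n) × ι) ℂ) (hH : IsSelfAdjoint H)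
    (hn : ‖H‖ ≤ 1) :
    ∃ π₁ π₂ : Unc n →⋆ₐ[ℂ] Matrix (Bool × ι) (Bool × ι) ℂ, ∀ i j a b,
      π₁ (Unc.u i j) (false, a) (false, b) + π₂ (Unc.u i j) (false, a) (false, b) =
        2 * H ((false, i), a) ((true, j), b) := by
  have hw := hH.self_add_I_smul_cfcSqrt_sub_sq_mem_unitary H hn
  obtain ⟨π₁, h₁⟩ := exists_rep_of_unitary _ hw
  obtain ⟨π₂, h₂⟩ := exists_rep_of_unitary _ (Unitary.star_mem hw)
  refine ⟨π₁, π₂, fun i j a b => ?_⟩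
  have hr : star (CFC.sqrt (1 - H ^ 2)) = CFC.sqrt (1 - H ^ 2) :=
    (CFC.sqrt_nonneg (1 - H ^ 2)).isSelfAdjoint.star_eq
  have hs : star (H + Complex.I • CFC.sqrt (1 - H ^ 2)) =
      H - Complex.I • CFC.sqrt (1 - H ^ 2) := by
    rw [star_add, star_smul, hr, hH.star_eq, RCLike.star_def, Complex.conj_I, neg_smul,
      ← sub_eq_add_neg]
  rw [h₁, h₂, hs, Matrix.add_apply, Matrix.sub_apply]
  ring

/-- Vector functionals of a representation of `U_nc(n)` are completely positive. -/
theorem sum_rep_nonneg {n p : ℕ} {κ : Type} [Fintype κ] [DecidableEq κ]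
    (π : Unc n →⋆ₐ[ℂ] Matrix κ κ ℂ) (v : Fin p → κ → ℂ)
    (P : Matrix (Fin p) (Fin p) (V n).toSubmodule) (hP : (V n).MatrixPos P) :
    0 ≤ ∑ a, ∑ b, star (v a) ⬝ᵥ (π (P a b : Unc n) *ᵥ v b) := by
  obtain ⟨Y, hY⟩ := hP
  have e : ∀ a b, π (P a b : Unc n) = ∑ e, (π (Y e a))ᴴ * π (Y e b) := fun a b => by
    have h := congrFun (congrFun hY a) b
    rw [map_apply, mul_apply] at h
    rw [h, map_sum]
    refine Finset.sum_congr rfl fun e _ => ?_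
    rw [conjTranspose_apply, map_mul, map_star]
    rfl
  have h : ∑ a, ∑ b, star (v a) ⬝ᵥ (π (P a b : Unc n) *ᵥ v b) =
      ∑ e, star (∑ a, π (Y e a) *ᵥ v a) ⬝ᵥ (∑ b, π (Y e b) *ᵥ v b) := by
    have h1 : ∀ e a b, star (v a) ⬝ᵥ (((π (Y e a))ᴴ * π (Y e b)) *ᵥ v b) =
        star (π (Y e a) *ᵥ v a) ⬝ᵥ (π (Y e b) *ᵥ v b) := fun e a b => by
      rw [← mulVec_mulVec, dotProduct_mulVec, star_mulVec]
    simp only [e, sum_mulVec, dotProduct_sum, star_sum, sum_dotProduct, h1]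
    rw [Finset.sum_comm]
    refine (Finset.sum_congr rfl fun b _ => Finset.sum_comm).trans ?_
    rw [Finset.sum_comm]
  rw [h]
  exact Finset.sum_nonneg fun e _ => dotProduct_star_self_nonneg _

/-! ### Matrices of functionals tested on (1, u; u⋆, 1). -/

/-- The adjoints `u_ij⋆` as elements of `V_n`. -/
def V.uStar {n : ℕ} (i j : Fin n) : (V n).toSubmodule :=
  ⟨star (Unc.u i j), Submodule.subset_span (Or.inr ⟨i, j, rfl⟩)⟩

/-- The positive matrix `(1, u; u⋆, 1)` over `V_n`. -/
def V.block (n : ℕ) : Matrix (Bool × Fin n) (Bool × Fin n) (V n).toSubmodule :=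
  Matrix.of fun c d =>
    if c.1 = d.1 then if c.2 = d.2 then (V n).unit else 0
    else if c.1 then V.uStar d.2 c.2 else V.u c.2 d.2

instance instModuleUnc (n : ℕ) : Module ℂ (Unc n) := Algebra.toModule

instance instMulActionUnc (n : ℕ) : MulAction ℂ (Unc n) := (instModuleUnc n).toMulAction

/-- Linear maps on `V_n` are determined by their values on `1`, `u_ij` and `u_ij⋆`. -/
theorem V.linearMap_ext {n : ℕ} {E : Type*} [AddCommMonoid E] [Module ℂ E]
    {f g : (V n).toSubmodule →ₗ[ℂ] E} (h1 : f (V n).unit = g (V n).unit)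
    (hu : ∀ i j, f (V.u i j) = g (V.u i j)) (hs : ∀ i j, f (V.uStar i j) = g (V.uStar i j)) :
    f = g := by
  refine LinearMap.ext fun x => ?_
  obtain ⟨x, hx⟩ := x
  induction hx using Submodule.span_induction with
  | mem x hx =>
    rcases hx with (hx | ⟨i, j, rfl⟩) | ⟨i, j, rfl⟩
    · obtain rfl := Set.mem_singleton_iff.1 hx
      exact h1
    · exact hu i j
    · exact hs i j
  | zero => exact (map_zero f).trans (map_zero g).symm
  | add x y hx hy h h' =>
    exact (map_add f ⟨x, hx⟩ ⟨y, hy⟩).trans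
      ((congrArg₂ (· + ·) h h').trans (map_add g ⟨x, hx⟩ ⟨y, hy⟩).symm)
  | smul c x hx h =>
    exact (map_smul f c ⟨x, hx⟩).trans ((congrArg (c • ·) h).trans (map_smul g c ⟨x, hx⟩).symm)

/-- The functional `x ↦ ⟨v, π(x) w⟩` on `V_n`. -/
def V.vectorFunctional {n : ℕ} {κ : Type} [Fintype κ] [DecidableEq κ]
    (π : Unc n →⋆ₐ[ℂ] Matrix κ κ ℂ) (v w : κ → ℂ) : (V n).toSubmodule →ₗ[ℂ] ℂ where
  toFun x := star v ⬝ᵥ (π (x : Unc n) *ᵥ w)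
  map_add' x y := by simp [add_mulVec]
  map_smul' c x := by
    have h : π ((c • x : (V n).toSubmodule) : Unc n) = c • π x :=
      π.toAlgHom.toLinearMap.map_smul c (x : Unc n)
    rw [h, smul_mulVec, dotProduct_smul, RingHom.id_apply]

/-- The values of a matrix of functionals on the matrix `(1, u; u⋆, 1)`. -/
def blockMatrix {n : ℕ} {ι : Type*} (g : ι → ι → (V n).toSubmodule →ₗ[ℂ] ℂ) :
    Matrix ((Bool × Fin n) × ι) ((Bool × Fin n) × ι) ℂ :=
  Matrix.of fun r c => g r.2 c.2 (V.block n r.1 c.1)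

theorem one_kronecker_conj_apply {ι κ : Type*} [Fintype ι] [Fintype κ] [DecidableEq κ]
    (B : Matrix ι ι ℂ) (H : Matrix (κ × ι) (κ × ι) ℂ) (r c : κ) (a b : ι) :
    (((1 : Matrix κ κ ℂ) ⊗ₖ B)ᴴ * H * ((1 : Matrix κ κ ℂ) ⊗ₖ B)) (r, a) (c, b) =
      ∑ x, ∑ y, star (B x a) * H (r, x) (c, y) * B y b := by
  simp only [mul_apply, conjTranspose_apply, kroneckerMap_apply, Fintype.sum_prod_type, one_apply]
  rw [Finset.sum_eq_single c (fun d _ hd => by simp [hd]) (by simp), Finset.sum_comm]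
  simp only [if_true, one_mul, Finset.sum_mul]
  refine Finset.sum_congr rfl fun y _ => ?_
  rw [Finset.sum_eq_single r (fun d _ hd => by simp [hd]) (by simp)]
  simp

/-- The off-diagonal part of a positive block matrix factors through a Hermitian contraction and a
square root of the common diagonal block. -/
theorem exists_contraction_of_blockMatrix {n p : ℕ}
    (g : Fin p → Fin p → (V n).toSubmodule →ₗ[ℂ] ℂ) (hg : (blockMatrix g).PosSemidef)
    (hd : (Matrix.of fun a b => g a b (V n).unit).PosDef) :
    ∃ (B : Matrix (Fin p) (Fin p) ℂ)
      (H : Matrix ((Bool × Fin n) × Fin p) ((Bool × Fin n) × Fin p) ℂ),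
      IsSelfAdjoint H ∧ ‖H‖ ≤ 1 ∧ (Matrix.of fun a b => g a b (V n).unit) = Bᴴ * B ∧
        blockMatrix g - 1 ⊗ₖ (Matrix.of fun a b => g a b (V n).unit) =
          (1 ⊗ₖ B)ᴴ * H * (1 ⊗ₖ B) := by
  set G : Matrix (Fin p) (Fin p) ℂ := Matrix.of fun a b => g a b (V n).unit with hG
  set M := blockMatrix g with hM
  obtain ⟨B, hB⟩ := CStarAlgebra.nonneg_iff_eq_star_mul_self.1 hd.posSemidef.nonneg
  rw [star_eq_conjTranspose] at hB
  have hBu : IsUnit B.det := by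
    have h := hd.det_pos.ne'
    rw [hB, det_mul] at h
    exact (right_ne_zero_of_mul h).isUnit
  let D : Matrix ((Bool × Fin n) × Fin p) ((Bool × Fin n) × Fin p) ℂ := 1 ⊗ₖ B
  let D' : Matrix ((Bool × Fin n) × Fin p) ((Bool × Fin n) × Fin p) ℂ := 1 ⊗ₖ B⁻¹
  have hDD : D' * D = 1 := by
    rw [← mul_kronecker_mul, nonsing_inv_mul _ hBu, Matrix.mul_one, one_kronecker_one]
  have hDD' : D * D' = 1 := by
    rw [← mul_kronecker_mul, mul_nonsing_inv _ hBu, Matrix.mul_one, one_kronecker_one]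
  have hD : (1 : Matrix (Bool × Fin n) (Bool × Fin n) ℂ) ⊗ₖ G = Dᴴ * D := by
    rw [conjTranspose_kronecker, ← mul_kronecker_mul, hB, conjTranspose_one, Matrix.one_mul]
  have hD1 : D'ᴴ * (Dᴴ * D) * D' = 1 := by
    rw [← Matrix.mul_assoc, ← conjTranspose_mul, Matrix.mul_assoc, hDD',
      conjTranspose_one, Matrix.mul_one]
  have hE : 0 ≤ D'ᴴ * M * D' := (hg.conjTranspose_mul_mul_same D').nonneg
  -- Conjugation by this sign matrix negates the off-diagonal blocks of `M`; positivity of the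
  -- result supplies the upper bound 2 below.
  let J : Matrix ((Bool × Fin n) × Fin p) ((Bool × Fin n) × Fin p) ℂ :=
    diagonal fun r => if r.1.1 then -1 else 1
  have hJ : Jᴴ * M * J = Dᴴ * D + Dᴴ * D - M := by
    rw [← hD]
    ext ⟨⟨s, i⟩, a⟩ ⟨⟨t, j⟩, b⟩
    simp only [J, diagonal_conjTranspose, diagonal_mul, mul_diagonal, Matrix.sub_apply,
      Matrix.add_apply, kroneckerMap_apply, one_apply, hM, blockMatrix, V.block, of_apply, hG]
    cases s <;> cases t <;> by_cases hij : i = j <;> simp [hij]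
  have hE2 : D'ᴴ * M * D' ≤ 2 := by
    have h := ((hg.conjTranspose_mul_mul_same J).conjTranspose_mul_mul_same D').nonneg
    rw [hJ, Matrix.mul_sub, Matrix.sub_mul, Matrix.mul_add, Matrix.add_mul, hD1,
      one_add_one_eq_two] at h
    exact sub_nonneg.1 h
  refine ⟨B, D'ᴴ * M * D' - 1, ?_, norm_sub_one_le_one hE hE2, hB, ?_⟩
  · exact ((nonneg_iff_posSemidef.1 hE).1.sub isHermitian_one :)
  · change M - 1 ⊗ₖ G = Dᴴ * (D'ᴴ * M * D' - 1) * D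
    have h1 : Dᴴ * D'ᴴ = 1 := by rw [← conjTranspose_mul, hDD, conjTranspose_one]
    rw [Matrix.mul_sub, Matrix.sub_mul, Matrix.mul_one, hD]
    congr 1
    calc M = Dᴴ * D'ᴴ * M * (D' * D) := by rw [h1, hDD, Matrix.one_mul, Matrix.mul_one]
      _ = _ := by simp only [Matrix.mul_assoc]

/-- Twice `g` is a sum of two matrices of vector functionals of representations, each of which is
completely positive. Positive definiteness at the unit allows dividing by its square root. -/
theorem sum_apply_nonneg_of_posDef {n p : ℕ}
    (g : Fin p → Fin p → (V n).toSubmodule →ₗ[ℂ] ℂ) (hg : (blockMatrix g).PosSemidef)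
    (hd : (Matrix.of fun a b => g a b (V n).unit).PosDef)
    (P : Matrix (Fin p) (Fin p) (V n).toSubmodule) (hP : (V n).MatrixPos P) :
    0 ≤ ∑ a, ∑ b, g a b (P a b) := by
  obtain ⟨B, H, hH, hH1, hB, hK⟩ := exists_contraction_of_blockMatrix g hg hd
  obtain ⟨π₁, π₂, hπ⟩ := exists_rep_of_contraction H hH hH1
  -- The columns of `B`, supported in the corner where the two representations average to `H`.
  let v : Fin p → Bool × Fin p → ℂ := fun b c => if c.1 then 0 else B c.2 b
  have hv : ∀ (Z : Matrix (Bool × Fin p) (Bool × Fin p) ℂ) a b, star (v a) ⬝ᵥ (Z *ᵥ v b) =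
      ∑ c, ∑ d, star (B c a) * Z (false, c) (false, d) * B d b := fun Z a b => by
    simp only [dotProduct, mulVec, Fintype.sum_prod_type, Fintype.sum_bool, v, Pi.star_apply]
    simp [Finset.mul_sum, mul_assoc]
  have key : ∀ a b, (2 : ℂ) • g a b =
      V.vectorFunctional π₁ (v a) (v b) + V.vectorFunctional π₂ (v a) (v b) := by
    have hu : ∀ i j a b, (2 : ℂ) • g a b (V.u i j) = V.vectorFunctional π₁ (v a) (v b) (V.u i j) +
        V.vectorFunctional π₂ (v a) (v b) (V.u i j) := fun i j a b => by
      have h := congrFun (congrFun hK ((false, i), a)) ((true, j), b)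
      rw [one_kronecker_conj_apply] at h
      simp only [Matrix.sub_apply, blockMatrix, V.block, of_apply, kroneckerMap_apply, one_apply,
        Prod.mk.injEq, Bool.false_eq_true, false_and, if_false, zero_mul, sub_zero] at h
      change _ = star (v a) ⬝ᵥ (π₁ (Unc.u i j) *ᵥ v b) + star (v a) ⬝ᵥ (π₂ (Unc.u i j) *ᵥ v b)
      rw [h, hv, hv, ← Finset.sum_add_distrib, Finset.smul_sum]
      refine Finset.sum_congr rfl fun x _ => ?_
      rw [← Finset.sum_add_distrib, Finset.smul_sum]
      refine Finset.sum_congr rfl fun y _ => ?_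
      rw [smul_eq_mul]
      linear_combination (-star (B x a) * B y b) * hπ i j x y
    have hsu : ∀ (π : Unc n →⋆ₐ[ℂ] Matrix (Bool × Fin p) (Bool × Fin p) ℂ) i j a b,
        V.vectorFunctional π (v a) (v b) (V.uStar i j) =
          star (V.vectorFunctional π (v b) (v a) (V.u i j)) := fun π i j a b => by
      change star (v a) ⬝ᵥ (π (star (Unc.u i j)) *ᵥ v b) =
        star (star (v b) ⬝ᵥ (π (Unc.u i j) *ᵥ v a))
      rw [map_star, ← star_dotProduct_star, star_star, star_mulVec, dotProduct_comm,
        ← dotProduct_mulVec, dotProduct_comm, star_eq_conjTranspose]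
    have hgs : ∀ i j a b, g a b (V.uStar i j) = star (g b a (V.u i j)) := fun i j a b =>
      (hg.1.apply ((true, j), a) ((false, i), b)).symm
    refine fun a b => V.linearMap_ext ?_ (fun i j => hu i j a b) fun i j => ?_
    · have h := congrFun (congrFun hB a) b
      have h1 : ∀ π : Unc n →⋆ₐ[ℂ] Matrix (Bool × Fin p) (Bool × Fin p) ℂ,
          V.vectorFunctional π (v a) (v b) (V n).unit = g a b (V n).unit := fun π => by
        change star (v a) ⬝ᵥ (π 1 *ᵥ v b) = _
        rw [of_apply] at h
        rw [h, map_one, hv, mul_apply]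
        simp [one_apply]
      rw [LinearMap.smul_apply, LinearMap.add_apply, h1, h1, two_smul]
    · rw [LinearMap.smul_apply, LinearMap.add_apply, hgs, hsu, hsu, ← star_add, ← hu, star_smul]
      simp
  have h : 0 ≤ (2 : ℂ) * ∑ a, ∑ b, g a b (P a b) := by
    have e : (2 : ℂ) * ∑ a, ∑ b, g a b (P a b) =
        ∑ a, ∑ b, star (v a) ⬝ᵥ (π₁ (P a b : Unc n) *ᵥ v b) +
          ∑ a, ∑ b, star (v a) ⬝ᵥ (π₂ (P a b : Unc n) *ᵥ v b) := by
      simp only [Finset.mul_sum, ← Finset.sum_add_distrib]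
      exact Finset.sum_congr rfl fun a _ => Finset.sum_congr rfl fun b _ =>
        LinearMap.congr_fun (key a b) (P a b)
    rw [e]
    exact add_nonneg (sum_rep_nonneg π₁ v P hP) (sum_rep_nonneg π₂ v P hP)
  exact le_of_mul_le_mul_left (by simpa using h) (by norm_num : (0 : ℂ) < 2)

/-! ### Constructing functionals, and removing the definiteness assumption. -/

theorem nonneg_of_forall_add_mul_nonneg {x y : ℂ} (h : ∀ ε : ℝ, 0 < ε → 0 ≤ x + (ε : ℂ) * y) :
    0 ≤ x := by
  have hc : Continuous fun ε : ℝ => x + (ε : ℂ) * y := by fun_prop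
  have ht : Filter.Tendsto (fun ε : ℝ => x + (ε : ℂ) * y) (nhdsWithin 0 (Set.Ioi 0))
      (nhds (x + ((0 : ℝ) : ℂ) * y)) := (hc.tendsto 0).mono_left nhdsWithin_le_nhds
  rw [Complex.ofReal_zero, zero_mul, add_zero] at ht
  exact ge_of_tendsto ht (Filter.eventually_of_mem self_mem_nhdsWithin fun ε hε => h ε hε)

/-- The functional on `V_n` induced by a unitary scalar matrix. -/
theorem V.exists_eval {n : ℕ} (W : Matrix (Fin n) (Fin n) ℂ) (hW : W ∈ unitary (Matrix _ _ ℂ))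
    (c : ℂ) (hc : star c * c = 1) :
    ∃ f : (V n).toSubmodule →ₗ[ℂ] ℂ, f (V n).unit = 1 ∧ (∀ i j, f (V.u i j) = c * W i j) ∧
      ∀ i j, f (V.uStar i j) = star c * star (W i j) := by
  obtain ⟨π, hπ, -⟩ := Unc.existsUnique_starAlgHom (n := n) (A := ℂ) (c • W) (by
    have h := Unitary.mem_iff.1 hW
    refine Unitary.mem_iff.2 ⟨?_, ?_⟩
    · rw [star_smul, smul_mul_smul_comm, h.1, hc, one_smul]
    · rw [star_smul, smul_mul_smul_comm, h.2, mul_comm, hc, one_smul])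
  refine ⟨π.toAlgHom.toLinearMap ∘ₗ (V n).toSubmodule.subtype, map_one π, hπ, fun i j => ?_⟩
  change π (star (Unc.u i j)) = _
  rw [map_star, hπ, Matrix.smul_apply, smul_eq_mul, star_mul, mul_comm]

/-- A functional on `V_n` vanishing on the `u_ij` and their adjoints. -/
theorem V.exists_unit_functional (n : ℕ) :
    ∃ f : (V n).toSubmodule →ₗ[ℂ] ℂ, f (V n).unit = 1 ∧ (∀ i j, f (V.u i j) = 0) ∧
      ∀ i j, f (V.uStar i j) = 0 := by
  obtain ⟨f, h1, h2, h3⟩ := V.exists_eval (1 : Matrix (Fin n) (Fin n) ℂ) (one_mem _) 1 (by simp)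
  obtain ⟨g, k1, k2, k3⟩ :=
    V.exists_eval (1 : Matrix (Fin n) (Fin n) ℂ) (one_mem _) (-1) (by simp)
  -- Averaging the evaluations at 1 and -1 cancels the generators.
  refine ⟨(2⁻¹ : ℂ) • (f + g), ?_, fun i j => ?_, fun i j => ?_⟩
  · simp [h1, k1]
    norm_num
  · simp [h2, k2]
  · simp [h3, k3]

/-- Functionals on `V_n` with prescribed values on the `u_ij`, respectively on their adjoints. -/
theorem V.exists_functionals {n : ℕ} (Z : Matrix (Fin n) (Fin n) ℂ) :
    ∃ f g : (V n).toSubmodule →ₗ[ℂ] ℂ,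
      (f (V n).unit = 0 ∧ (∀ i j, f (V.u i j) = Z i j) ∧ ∀ i j, f (V.uStar i j) = 0) ∧
      (g (V n).unit = 0 ∧ (∀ i j, g (V.u i j) = 0) ∧ ∀ i j, g (V.uStar i j) = star (Z i j)) := by
  have hZ : Z ∈ Submodule.span ℂ (unitary (Matrix (Fin n) (Fin n) ℂ) : Set _) := by
    rw [CStarAlgebra.span_unitary]
    trivial
  induction hZ using Submodule.span_induction with
  | mem W hW =>
    obtain ⟨f₁, a1, a2, a3⟩ := V.exists_eval W hW 1 (by simp)
    obtain ⟨f₂, b1, b2, b3⟩ := V.exists_eval W hW (-1) (by simp)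
    obtain ⟨f₃, c1, c2, c3⟩ := V.exists_eval W hW Complex.I (by simp)
    obtain ⟨f₄, d1, d2, d3⟩ := V.exists_eval W hW (-Complex.I) (by simp)
    have hI := Complex.I_mul_I
    -- Fourier inversion over the fourth roots of unity c: the values at 1, u and u⋆ scale by 1, c
    -- and the conjugate of c, so each can be isolated.
    refine ⟨(4⁻¹ : ℂ) • (f₁ - f₂ - Complex.I • f₃ + Complex.I • f₄),
      (4⁻¹ : ℂ) • (f₁ - f₂ + Complex.I • f₃ - Complex.I • f₄),
      ⟨?_, fun i j => ?_, fun i j => ?_⟩, ⟨?_, fun i j => ?_, fun i j => ?_⟩⟩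
    · simp [a1, b1, c1, d1]
    · simp [a2, b2, c2, d2]
      linear_combination (-(1 / 2) * W i j) * hI
    · simp [a3, b3, c3, d3]
      linear_combination ((1 / 2) * (starRingEnd ℂ) (W i j)) * hI
    · simp [a1, b1, c1, d1]
    · simp [a2, b2, c2, d2]
      linear_combination (2 * W i j) * hI
    · simp [a3, b3, c3, d3]
      linear_combination (-(1 / 2) * (starRingEnd ℂ) (W i j)) * hI
  | zero => exact ⟨0, 0, by simp, by simp⟩
  | add x y _ _ hx hy =>
    obtain ⟨f, g, ⟨a1, a2, a3⟩, b1, b2, b3⟩ := hx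
    obtain ⟨f', g', ⟨a1', a2', a3'⟩, b1', b2', b3'⟩ := hy
    exact ⟨f + f', g + g', by simp [a1, a2, a3, a1', a2', a3'],
      by simp [b1, b2, b3, b1', b2', b3']⟩
  | smul c x _ hx =>
    obtain ⟨f, g, ⟨a1, a2, a3⟩, b1, b2, b3⟩ := hx
    exact ⟨c • f, star c • g, by simp [a1, a2, a3], by simp [b1, b2, b3]⟩

/-- If a matrix of functionals has a positive semidefinite block matrix, then it is a positive
functional on matrices over `V_n`. -/
theorem sum_apply_nonneg {n p : ℕ} (hn : 0 < n)
    (g : Fin p → Fin p → (V n).toSubmodule →ₗ[ℂ] ℂ) (hg : (blockMatrix g).PosSemidef)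
    (P : Matrix (Fin p) (Fin p) (V n).toSubmodule) (hP : (V n).MatrixPos P) :
    0 ≤ ∑ a, ∑ b, g a b (P a b) := by
  obtain ⟨φ, φ1, φu, φs⟩ := V.exists_unit_functional n
  refine nonneg_of_forall_add_mul_nonneg (y := ∑ a, φ (P a a)) fun ε hε => ?_
  -- Adding ε`φ` on the diagonal adds ε times the identity to the block matrix and makes the unit
  -- block definite.
  let g' : Fin p → Fin p → (V n).toSubmodule →ₗ[ℂ] ℂ :=
    fun a b => g a b + (if a = b then (ε : ℂ) else 0) • φ
  have hε' : (0 : ℂ) ≤ ε := by exact_mod_cast hε.le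
  have h1 : blockMatrix g' = blockMatrix g + (ε : ℂ) • 1 := by
    ext ⟨⟨s, i⟩, a⟩ ⟨⟨t, j⟩, b⟩
    simp only [blockMatrix, V.block, of_apply, Matrix.add_apply, Matrix.smul_apply, one_apply, g',
      LinearMap.add_apply, LinearMap.smul_apply]
    cases s <;> cases t <;> by_cases hij : i = j <;> by_cases hab : a = b <;>
      simp [hij, hab, φ1, φu, φs]
  have h2 : (Matrix.of fun a b => g' a b (V n).unit) =
      (Matrix.of fun a b => g a b (V n).unit) + (ε : ℂ) • 1 := by
    ext a b
    by_cases hab : a = b <;> simp [g', hab, φ1]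
  have h3 : (Matrix.of fun a b => g a b (V n).unit).PosSemidef := by
    convert hg.submatrix fun a : Fin p => (((false, ⟨0, hn⟩) : Bool × Fin n), a) using 1
    ext a b
    simp [blockMatrix, V.block]
  have h4 := sum_apply_nonneg_of_posDef g'
    (h1 ▸ hg.add (PosSemidef.one.smul hε'))
    (h2 ▸ PosDef.posSemidef_add h3 (PosDef.one.smul (by exact_mod_cast hε))) P hP
  convert h4 using 1
  have h5 : ∀ a b x, g' a b x = g a b x + (if a = b then (ε : ℂ) else 0) * φ x := fun _ _ _ => rfl
  simp [h5, Finset.sum_add_distrib, Finset.mul_sum]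

/-! ### Sufficiency: positive block values give a state. -/

/-- The values of a functional on the tensor product of the matrices `(1, u; u⋆, 1)`. -/
def tensorBlockMatrix {n m : ℕ} (s : (V n).toSubmodule ⊗[ℂ] (V m).toSubmodule →ₗ[ℂ] ℂ) :
    Matrix ((Bool × Fin n) × (Bool × Fin m)) ((Bool × Fin n) × (Bool × Fin m)) ℂ :=
  Matrix.of fun r c => s (V.block n r.1 c.1 ⊗ₜ[ℂ] V.block m r.2 c.2)

/-- A quadratic form in the coefficients `ξ (c, a) γ (a, i)` depends only on their sums over
`a`. -/
theorem sum_quadratic_contract {C A I : Type*} [Fintype C] [Fintype A] [Fintype I]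
    (ξ : C × A → ℂ) (γ : A → I → ℂ) (F : C → C → I → I → ℂ) :
    ∑ r, ∑ c, star (ξ r) * ξ c * ∑ i, ∑ j, star (γ r.2 i) * γ c.2 j * F r.1 c.1 i j =
      ∑ i, ∑ j, ∑ c, ∑ d,
        star (∑ a, ξ (c, a) * γ a i) * (∑ b, ξ (d, b) * γ b j) * F c d i j := by
  simp only [star_sum, Finset.sum_mul, Finset.mul_sum]
  simp only [← Fintype.sum_prod_type']
  -- Only a reordering of the six summation variables.
  refine Fintype.sum_equiv
    ⟨fun x => ⟨x.2.2.1, x.2.2.2, x.1.1, x.2.1.1, x.2.1.2, x.1.2⟩,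
      fun y => ⟨⟨y.2.2.1, y.2.2.2.2.2⟩, ⟨y.2.2.2.1, y.2.2.2.2.1⟩, y.1, y.2.1⟩,
      fun _ => rfl, fun _ => rfl⟩ _ _ fun x => ?_
  rw [Equiv.coe_fn_mk, star_mul]
  ring

/-- Freezing `Q` leaves functionals on `V n`, so `P` may be replaced by the block matrix; freezing
that one does the same for `Q`. What remains is a quadratic form of `tensorBlockMatrix s`. -/
theorem sum_apply_tensor_nonneg {n m p q : ℕ} (hn : 0 < n) (hm : 0 < m)
    (s : (V n).toSubmodule ⊗[ℂ] (V m).toSubmodule →ₗ[ℂ] ℂ) (hs : (tensorBlockMatrix s).PosSemidef)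
    (P : Matrix (Fin p) (Fin p) (V n).toSubmodule) (hP : (V n).MatrixPos P)
    (Q : Matrix (Fin q) (Fin q) (V m).toSubmodule) (hQ : (V m).MatrixPos Q)
    (γ : Fin p → Fin q → ℂ) :
    0 ≤ ∑ a, ∑ b, ∑ i, ∑ j, star (γ a i) * γ b j * s (P a b ⊗ₜ[ℂ] Q i j) := by
  let g : Fin p → Fin p → (V n).toSubmodule →ₗ[ℂ] ℂ := fun a b =>
    ∑ i, ∑ j, (star (γ a i) * γ b j) • (s ∘ₗ (TensorProduct.mk ℂ _ _).flip (Q i j))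
  have hg := sum_apply_nonneg hn g ?_ P hP
  · simpa [g] using hg
  rw [posSemidef_iff_sum]
  intro ξ
  let β : Bool × Fin n → Fin q → ℂ := fun c i => ∑ a, ξ (c, a) * γ a i
  let h : Fin q → Fin q → (V m).toSubmodule →ₗ[ℂ] ℂ := fun i j =>
    ∑ c, ∑ d, (star (β c i) * β d j) • (s ∘ₗ TensorProduct.mk ℂ _ _ (V.block n c d))
  have hh := sum_apply_nonneg hm h ?_ Q hQ
  · have e := sum_quadratic_contract ξ γ fun c d i j => s (V.block n c d ⊗ₜ[ℂ] Q i j)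
    simp only [blockMatrix, of_apply, g, LinearMap.sum_apply, LinearMap.smul_apply,
      LinearMap.comp_apply, LinearMap.flip_apply, TensorProduct.mk_apply, smul_eq_mul, h] at hh ⊢
    rw [e]
    exact hh
  rw [posSemidef_iff_sum]
  intro η
  have e := sum_quadratic_contract η (fun i c => β c i)
    fun e f c d => s (V.block n c d ⊗ₜ[ℂ] V.block m e f)
  simp only [blockMatrix, of_apply, LinearMap.sum_apply, LinearMap.smul_apply,
    LinearMap.comp_apply, TensorProduct.mk_apply, smul_eq_mul, h] at e ⊢
  rw [e]
  have hN := (posSemidef_iff_sum _).1 hs fun r => ∑ i, η (r.2, i) * β r.1 i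
  simp only [Fintype.sum_prod_type (α₁ := Bool × Fin n), tensorBlockMatrix, of_apply] at hN
  convert hN using 2 with c
  rw [Finset.sum_comm]

/-- A unital functional with positive semidefinite block matrix is a state on the maximal tensor
product. -/
theorem isMaxState_of_tensorBlockMatrix {n m : ℕ} (hn : 0 < n) (hm : 0 < m)
    (s : (V n).toSubmodule ⊗[ℂ] (V m).toSubmodule →ₗ[ℂ] ℂ) (hs : (tensorBlockMatrix s).PosSemidef)
    (h1 : s ((V n).unit ⊗ₜ[ℂ] (V m).unit) = 1) : (V n).IsMaxState (V m) s := by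
  refine ⟨h1, fun x hx => nonneg_of_forall_add_mul_nonneg (y := 1) fun ε hε => ?_⟩
  obtain ⟨p, q, P, Q, α, hP, hQ, h⟩ := hx ε hε
  have h' := congrArg s (congrFun (congrFun h 0) 0)
  have hc := sum_apply_tensor_nonneg hn hm s hs P hP Q hQ fun a i => α (a, i) 0
  simp only [Matrix.add_apply, of_apply, diagonal_apply_eq, map_add, map_smul, h1,
    OperatorSystem.compress, OperatorSystem.tensorMatrix, map_sum, smul_eq_mul] at h'
  rw [h']
  simp only [Fintype.sum_prod_type]
  convert hc using 2 with a
  rw [Finset.sum_comm]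

/-! ### Necessity: a state has positive block values. -/

/-- The matrix `(1, u; u⋆, 1)` is of the form `Y⋆ Y`. -/
theorem V.block_eq_conjTranspose_mul (n : ℕ) :
    ∃ Y : Matrix (Bool × Fin n) (Bool × Fin n) (Unc n),
      (V.block n).map (fun x => (x : Unc n)) = Y.conjTranspose * Y := by
  have hu := (Unitary.mem_iff.1 (Unc.u_mem_unitary n)).1
  -- The block row (1, u) padded by a zero row; only u⋆u = 1 is needed.
  refine ⟨Matrix.of fun c d => if c.1 then 0 else if d.1 then Unc.u c.2 d.2 else
    if c.2 = d.2 then 1 else 0, ?_⟩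
  ext1 ⟨s, i⟩ ⟨t, j⟩
  have h := congrFun (congrFun hu i) j
  simp only [mul_apply, star_apply, of_apply] at h
  rw [mul_apply, Fintype.sum_prod_type, Fintype.sum_bool]
  cases s <;> cases t
  · rcases eq_or_ne i j with rfl | hij
    · simp [V.block, conjTranspose_apply, OperatorSystem.unit, apply_ite (star (R := Unc n))]
    · simp [V.block, conjTranspose_apply, apply_ite (star (R := Unc n)), hij, hij.symm]
  · simp [V.block, conjTranspose_apply, V.u, apply_ite (star (R := Unc n))]
  · simp [V.block, conjTranspose_apply, V.uStar]
  · simp only [V.block, conjTranspose_apply, OperatorSystem.unit, map_apply, of_apply]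
    simp only [if_true, if_false, Bool.false_eq_true, h, mul_zero, Finset.sum_const_zero, zero_add]
    by_cases hij : i = j <;> simp [hij, one_apply]

namespace OperatorSystem

variable {A B : Type*} [CStarAlgebra A] [CStarAlgebra B]

/-- A positive matrix over a finite index type, enlarged by the unit, is positive over `Fin p`. -/
theorem exists_matrixPos_option {ι : Type*} [Fintype ι] (S : OperatorSystem A)
    (P : Matrix ι ι S.toSubmodule)
    (hP : ∃ Y : Matrix ι ι A, P.map (fun x => (x : A)) = Y.conjTranspose * Y) :
    ∃ (p : ℕ) (e : Option ι ≃ Fin p) (P' : Matrix (Fin p) (Fin p) S.toSubmodule),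
      S.MatrixPos P' ∧ P' (e none) (e none) = S.unit ∧
        (∀ i, P' (e none) (e (some i)) = 0) ∧ (∀ i, P' (e (some i)) (e none) = 0) ∧
        ∀ i j, P' (e (some i)) (e (some j)) = P i j := by
  obtain ⟨Y, hY⟩ := hP
  let e := Fintype.equivFin (Option ι)
  let P₀ : Matrix (Option ι) (Option ι) S.toSubmodule := Matrix.of fun a b =>
    match a, b with
    | none, none => S.unit
    | some i, some j => P i j
    | _, _ => 0
  let Y₀ : Matrix (Option ι) (Option ι) A := Matrix.of fun a b =>
    match a, b with
    | none, none => 1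
    | some i, some j => Y i j
    | _, _ => 0
  have h₀ : P₀.map (fun x => (x : A)) = Y₀.conjTranspose * Y₀ := by
    ext1 a b
    rw [mul_apply, Fintype.sum_option]
    cases a <;> cases b
    · simp [P₀, Y₀, unit, conjTranspose_apply]
    · simp [P₀, Y₀, conjTranspose_apply]
    · simp [P₀, Y₀, conjTranspose_apply]
    · rename_i i j
      have h := congrFun (congrFun hY i) j
      rw [mul_apply, map_apply] at h
      simp [P₀, Y₀, conjTranspose_apply, h]
  refine ⟨_, e, P₀.submatrix e.symm e.symm, ⟨Y₀.submatrix e.symm e.symm, ?_⟩, ?_,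
    fun i => ?_, fun i => ?_, fun i j => ?_⟩
  · rw [conjTranspose_submatrix, submatrix_mul_equiv, ← h₀]
    rfl
  all_goals simp [P₀]

/-- Compressions of tensor products of positive matrices are positive in the maximal tensor
product. -/
theorem maxTensorPos_compress {ι κ : Type*} [Fintype ι] [Fintype κ] (S : OperatorSystem A)
    (T : OperatorSystem B) (P : Matrix ι ι S.toSubmodule) (Q : Matrix κ κ T.toSubmodule)
    (hP : ∃ Y : Matrix ι ι A, P.map (fun x => (x : A)) = Y.conjTranspose * Y)
    (hQ : ∃ Y : Matrix κ κ B, Q.map (fun x => (x : B)) = Y.conjTranspose * Y)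
    (γ : ι × κ → ℂ) :
    S.MaxTensorPos T (Matrix.of fun _ _ : Fin 1 =>
      ∑ i, ∑ j, (star (γ i) * γ j) • (P i.1 j.1 ⊗ₜ[ℂ] Q i.2 j.2)) := by
  intro ε hε
  obtain ⟨p, e, P', hP', hP0, hP2, hP3, hP1⟩ := S.exists_matrixPos_option P hP
  obtain ⟨q, f, Q', hQ', hQ0, hQ2, hQ3, hQ1⟩ := T.exists_matrixPos_option Q hQ
  -- The adjoined unit indices produce exactly ε(1 ⊗ 1), and mixed pairs get weight 0 so that no
  -- cross terms appear.
  let δ : Option ι × Option κ → ℂ := fun x =>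
    match x with
    | (none, none) => (Real.sqrt ε : ℂ)
    | (some i, some k) => γ (i, k)
    | _ => 0
  refine ⟨p, q, P', Q', Matrix.of fun x _ => δ (e.symm x.1, f.symm x.2), hP', hQ', ?_⟩
  ext1 a b
  obtain rfl := Subsingleton.elim a b
  have hsq : star (Real.sqrt ε : ℂ) * (Real.sqrt ε : ℂ) = ε := by
    rw [RCLike.star_def, Complex.conj_ofReal, ← Complex.ofReal_mul, Real.mul_self_sqrt hε.le]
  simp only [Matrix.add_apply, of_apply, diagonal_apply_eq, compress, tensorMatrix]
  rw [← (Equiv.prodCongr e f).sum_comp]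
  simp only [← (Equiv.prodCongr e f).sum_comp (fun y : Fin p × Fin q => _ • _)]
  simp only [Equiv.prodCongr_apply, Prod.map_fst, Prod.map_snd, Equiv.symm_apply_apply]
  simp only [Fintype.sum_prod_type, Fintype.sum_option]
  simp only [δ, hP0, hP1, hP2, hP3, hQ0, hQ1, hsq, star_zero, zero_mul, mul_zero, zero_smul,
    TensorProduct.zero_tmul, smul_zero, Finset.sum_const_zero, add_zero, zero_add]
  rw [add_comm]

end OperatorSystem

theorem posSemidef_tensorBlockMatrix {n m : ℕ}
    (s : (V n).toSubmodule ⊗[ℂ] (V m).toSubmodule →ₗ[ℂ] ℂ) (hs : (V n).IsMaxState (V m) s) :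
    (tensorBlockMatrix s).PosSemidef := by
  rw [posSemidef_iff_sum]
  intro γ
  have h := hs.map_nonneg _ ((V n).maxTensorPos_compress (V m) _ _
    (V.block_eq_conjTranspose_mul n) (V.block_eq_conjTranspose_mul m) γ)
  simpa [tensorBlockMatrix] using h

/-- Keeping only the indices whose two Booleans agree compresses the positive matrix to (1, X; X⋆,
1). -/
theorem norm_correlationMatrix_le_one {n m : ℕ}
    (s : (V n).toSubmodule ⊗[ℂ] (V m).toSubmodule →ₗ[ℂ] ℂ) (hs : (V n).IsMaxState (V m) s) :
    ‖correlationMatrix s‖ ≤ 1 := by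
  have hN := posSemidef_tensorBlockMatrix s hs
  rw [← posSemidef_fromBlocks_one_iff]
  convert hN.submatrix (Sum.elim (fun i : Fin n × Fin m => ((false, i.1), (false, i.2)))
    fun i : Fin n × Fin m => ((true, i.1), (true, i.2))) using 1
  ext1 x y
  rcases x with ⟨i, k⟩ | ⟨i, k⟩ <;> rcases y with ⟨j, l⟩ | ⟨j, l⟩
  · by_cases hij : i = j <;> by_cases hkl : k = l <;>
      simp [tensorBlockMatrix, V.block, hij, hkl, one_apply, hs.map_unit]
  · simp [tensorBlockMatrix, V.block, correlationMatrix]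
  · have h := hN.1.apply ((true, i), (true, k)) ((false, j), (false, l))
    simp only [tensorBlockMatrix, V.block, of_apply] at h
    simpa [tensorBlockMatrix, V.block, correlationMatrix] using h
  · by_cases hij : i = j <;> by_cases hkl : k = l <;>
      simp [tensorBlockMatrix, V.block, hij, hkl, one_apply, hs.map_unit]

/-! ### Realising every contraction by a state. -/

/-- The product functional `f ⊗ g`. -/
def tensorFunctional {n m : ℕ} (f : (V n).toSubmodule →ₗ[ℂ] ℂ) (g : (V m).toSubmodule →ₗ[ℂ] ℂ) :
    (V n).toSubmodule ⊗[ℂ] (V m).toSubmodule →ₗ[ℂ] ℂ :=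
  LinearMap.mul' ℂ ℂ ∘ₗ TensorProduct.map f g

theorem tensorFunctional_tmul {n m : ℕ} (f : (V n).toSubmodule →ₗ[ℂ] ℂ)
    (g : (V m).toSubmodule →ₗ[ℂ] ℂ) (x : (V n).toSubmodule) (y : (V m).toSubmodule) :
    tensorFunctional f g (x ⊗ₜ[ℂ] y) = f x * g y := rfl

/-- Functionals with prescribed values on `1 ⊗ 1`, `u ⊗ v` and `u⋆ ⊗ v⋆`, and with value zero on
the other products of generators. -/
theorem exists_functional_of_matrix {n m : ℕ} (X : Matrix (Fin n × Fin m) (Fin n × Fin m) ℂ) :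
    ∃ s : (V n).toSubmodule ⊗[ℂ] (V m).toSubmodule →ₗ[ℂ] ℂ,
      s ((V n).unit ⊗ₜ[ℂ] (V m).unit) = 1 ∧
      (∀ k l, s ((V n).unit ⊗ₜ[ℂ] V.u k l) = 0) ∧
      (∀ k l, s ((V n).unit ⊗ₜ[ℂ] V.uStar k l) = 0) ∧
      (∀ i j, s (V.u i j ⊗ₜ[ℂ] (V m).unit) = 0) ∧
      (∀ i j, s (V.uStar i j ⊗ₜ[ℂ] (V m).unit) = 0) ∧
      (∀ i j k l, s (V.u i j ⊗ₜ[ℂ] V.u k l) = X (i, k) (j, l)) ∧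
      (∀ i j k l, s (V.u i j ⊗ₜ[ℂ] V.uStar k l) = 0) ∧
      (∀ i j k l, s (V.uStar i j ⊗ₜ[ℂ] V.u k l) = 0) ∧
      ∀ i j k l, s (V.uStar i j ⊗ₜ[ℂ] V.uStar k l) = star (X (i, k) (j, l)) := by
  obtain ⟨φ, a1, a2, a3⟩ := V.exists_unit_functional n
  obtain ⟨ψ, b1, b2, b3⟩ := V.exists_unit_functional m
  -- Matrix units give functionals dual to the generators and to their adjoints.
  choose f f' hf hf' using fun i j => V.exists_functionals (Matrix.single i j (1 : ℂ) :
    Matrix (Fin n) (Fin n) ℂ)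
  choose g g' hg hg' using fun i j => V.exists_functionals (Matrix.single i j (1 : ℂ) :
    Matrix (Fin m) (Fin m) ℂ)
  refine ⟨tensorFunctional φ ψ +
    ∑ r, ∑ c, (X r c • tensorFunctional (f r.1 c.1) (g r.2 c.2) +
      star (X r c) • tensorFunctional (f' r.1 c.1) (g' r.2 c.2)), ?_⟩
  have key : ∀ (Z : Matrix (Fin n × Fin m) (Fin n × Fin m) ℂ) i j k l,
      ∑ r, ∑ c, Z r c * (Matrix.single r.1 c.1 (1 : ℂ) i j * Matrix.single r.2 c.2 (1 : ℂ) k l) =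
        Z (i, k) (j, l) := fun Z i j k l => by
    rw [Finset.sum_eq_single (i, k), Finset.sum_eq_single (j, l)]
    · simp
    · rintro ⟨j', l'⟩ - h
      simp only [single_apply]
      aesop
    · simp
    · rintro ⟨i', k'⟩ - h
      simp only [single_apply]
      refine Finset.sum_eq_zero fun c _ => ?_
      aesop
    · simp
  refine ⟨?_, ?_, ?_, ?_, ?_, ?_, ?_, ?_, ?_⟩ <;> intros <;>
    simp only [LinearMap.add_apply, LinearMap.sum_apply, LinearMap.smul_apply,
      tensorFunctional_tmul, a1, a2, a3, b1, b2, b3, (hf _ _).1, (hf _ _).2.1, (hf _ _).2.2,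
      (hg _ _).1, (hg _ _).2.1, (hg _ _).2.2, (hf' _ _).1, (hf' _ _).2.1, (hf' _ _).2.2,
      (hg' _ _).1, (hg' _ _).2.1, (hg' _ _).2.2, mul_zero, zero_mul, add_zero, zero_add,
      Finset.sum_const_zero, mul_one, smul_eq_mul, key]
  rename_i i j k l
  rw [← key X i j k l]
  simp only [star_sum, star_mul']

theorem posSemidef_tensorBlockMatrix_of_contraction {n m : ℕ}
    {X : Matrix (Fin n × Fin m) (Fin n × Fin m) ℂ} (hX : ‖X‖ ≤ 1) :
    ∃ s : (V n).toSubmodule ⊗[ℂ] (V m).toSubmodule →ₗ[ℂ] ℂ, (tensorBlockMatrix s).PosSemidef ∧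
      s ((V n).unit ⊗ₜ[ℂ] (V m).unit) = 1 ∧ X = correlationMatrix s := by
  obtain ⟨s, h1, h2, h3, h4, h5, h6, h7, h8, h9⟩ := exists_functional_of_matrix X
  refine ⟨s, ?_, h1, by ext ⟨i, k⟩ ⟨j, l⟩; exact (h6 i j k l).symm⟩
  have hE := (posSemidef_fromBlocks_one_iff X).2 hX
  let e : (Bool × Fin n) × (Bool × Fin m) → (Fin n × Fin m) ⊕ (Fin n × Fin m) :=
    fun x => if x.1.1 then Sum.inr (x.1.2, x.2.2) else Sum.inl (x.1.2, x.2.2)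
  -- This cuts down to agreeing Booleans, where `e` is a bijection; on the complement the block
  -- matrix is the identity.
  let t : (Bool × Fin n) × (Bool × Fin m) → ℂ := fun x => if x.1.1 = x.2.1 then 1 else 0
  have hN : tensorBlockMatrix s = (diagonal t)ᴴ * (fromBlocks 1 X Xᴴ 1).submatrix e e * diagonal t +
      diagonal (1 - t) := by
    ext1 ⟨⟨c, i⟩, ⟨c', k⟩⟩ ⟨⟨d, j⟩, ⟨d', l⟩⟩
    simp only [diagonal_conjTranspose, Matrix.add_apply, diagonal_mul, mul_diagonal,
      submatrix_apply, tensorBlockMatrix, of_apply, V.block, diagonal_apply, t, e]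
    cases c <;> cases d <;> cases c' <;> cases d' <;> by_cases hij : i = j <;>
      by_cases hkl : k = l <;>
      simp [hij, hkl, h1, h2, h3, h4, h5, h6, h7, h8, h9, one_apply]
  rw [hN]
  refine ((hE.submatrix e).conjTranspose_mul_mul_same _).add (PosSemidef.diagonal fun x => ?_)
  by_cases h : x.1.1 = x.2.1 <;> simp [t, h]

theorem Bqmax_eq {n m : ℕ} (hn : 0 < n) (hm : 0 < m) : Bqmax n m = {X | ‖X‖ ≤ 1} := by
  ext X
  constructor
  · rintro ⟨s, hs, rfl⟩
    exact norm_correlationMatrix_le_one s hs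
  · intro hX
    obtain ⟨s, hs, h1, h⟩ := posSemidef_tensorBlockMatrix_of_contraction hX
    exact ⟨s, isMaxState_of_tensorBlockMatrix hn hm s hs h1, h⟩

end QMax

end

theorem mainTheorem3 (n m : ℕ) (hn : 2 ≤ n) (hm : 2 ≤ m) :
    QMax.Bqmax n m = {X | ‖X‖ ≤ 1} ∧
      ∀ X : Matrix (Fin n × Fin m) (Fin n × Fin m) ℂ, QMax.qmaxNorm X = ‖X‖ := by
  have h := QMax.Bqmax_eq (n := n) (m := m) (by omega) (by omega)
  refine ⟨h, fun X => ?_⟩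
  have hb : {X : Matrix (Fin n × Fin m) (Fin n × Fin m) ℂ | ‖X‖ ≤ 1} = Metric.closedBall 0 1 := by
    ext Y
    simp
  rw [QMax.qmaxNorm, h, hb, gauge_closedBall zero_le_one, div_one]
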